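/- Let $\mathcal A,\mathcal B,\mathcal C$ be abelian categories. A recollement $(\mathcal A,\mathcal B,\mathcal C)$ consists of functors $i^*,i^!:\mathcal B\to\mathcal A$, $i_*:\mathcal A\to\mathcal B$, $j_!,j_*:\mathcal C\to\mathcal B$, $j^*:\mathcal B\to\mathcal C$ such that $(i^*,i_*,i^!)$ and $(j_!,j^*,j_*)$ are adjoint triples, $i_*,j_!,j_*$ are fully faithful, and the essential image of $i_*$ is $\operatorname{Ker} j^*$. Let $\mathcal X,\mathcal Y$ be full additive subcategories, closed under direct summands (hence under isomorphisms), of an abelian category $\mathcal D$. A short exact sequence $0\to K\to L\to M\to 0$ in $\mathcal D$ is called $\mathcal D(\mathcal X,-)$-exact if $0\to\mathcal D(X,K)\to\mathcal D(X,L)\to\mathcal D(X,M)\to0$ is exact for all $X\in\mathcal X$, and $\mathcal D(-,\mathcal Y)$-exact if $0\to\mathcal D(M,Y)\to\mathcal D(L,Y)\to\mathcal D(K,Y)\to0$ is exact for all $Y\in\mathcal Y$. The pair $(\mathcal X,\mathcal Y)$ is a *balanced pair* in $\mathcal D$ if: * (B1) for every object $M$ there are a $\mathcal D(\mathcal X,-)$-exact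 short exact sequence $0\to K\to X_0\to M\to0$ with $X_0\in\mathcal X$ and a $\mathcal D(-,\mathcal Y)$-exact short exact sequence $0\to M\to Y_0\to L\to0$ with $Y_0\in\mathcal Y$; * (B2) for every object $M$ there is an exact complex $\cdots\to X_1\to X_0\to M\to0$ with all $X_n\in\mathcal X$, obtained by splicing short exact sequences that are both $\mathcal D(\mathcal X,-)$-exact and $\mathcal D(-,\mathcal Y)$-exact; * (B3) for every object $M$ there is an exact complex $0\to M\to Y_0\to Y_{-1}\to\cdots$ with all $Y_n\in\mathcal Y$, obtained by splicing short exact sequences that are both $\mathcal D(\mathcal X,-)$-exact and $\mathcal D(-,\mathcal Y)$-exact. **Corollary.** Let $(\mathcal A,\mathcal B,\mathcal C)$ be a recollement of abelian categories and $(\mathcal X,\mathcal Y)$ a balanced pair in $\mathcal B$ with $j_!j^*\mathcal X\subseteq\mathcal X$, $j_*j^*\mathcal Y\subseteq\mathcal Y$, $i_*i^*\mathcal X\subseteq\mathcal X$ and $i_*i^!\mathcal Y\subseteq\mathcal Y$. Then 1. $(j^*\mathcal X,j^*\mathcal Y)$ is a balanced pair in $\mathcal C$; 2. $(i^*\mathcal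 X,i^!\mathcal Y)$ is a balanced pair in $\mathcal A$. Here $F\mathcal X$ denotes the full subcategory of objects isomorphic to $FX$ for some $X\in\mathcal X$. -/

import Mathlib

open CategoryTheory CategoryTheory.Limits

universe v v₁ v₂ v₃ u u₁ u₂ u₃

namespace GluedPairs

/-- A recollement of the abelian category `B` relative to the abelian categories `A` and `C`:
adjoint triples `i^* ⊣ i_* ⊣ i^!` and `j_! ⊣ j^* ⊣ j_*` with `i_*`, `j_!`, `j_*` fully faithful and
the (essential) image of `i_*` equal to the kernel of `j^*`. The adjunctions make all six functors
additive, make `i_*` and `j^*` exact, `i^*` and `j_!` right exact, `i^!` and `j_*` left exact. -/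
structure Recollement (A : Type u₁) [Category.{v₁} A] [Abelian A]
    (B : Type u₂) [Category.{v₂} B] [Abelian B]
    (C : Type u₃) [Category.{v₃} C] [Abelian C] where
  /-- the functor `i^* : B ⥤ A` -/
  iUpperStar : B ⥤ A
  /-- the functor `i_* : A ⥤ B` -/
  iLowerStar : A ⥤ B
  /-- the functor `i^! : B ⥤ A` -/
  iUpperShriek : B ⥤ A
  /-- the functor `j_! : C ⥤ B` -/
  jLowerShriek : C ⥤ B
  /-- the functor `j^* : B ⥤ C` -/
  jUpperStar : B ⥤ C
  /-- the functor `j_* : C ⥤ B` -/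
  jLowerStar : C ⥤ B
  iAdj : iUpperStar ⊣ iLowerStar
  iAdj' : iLowerStar ⊣ iUpperShriek
  jAdj : jLowerShriek ⊣ jUpperStar
  jAdj' : jUpperStar ⊣ jLowerStar
  iLowerStar_full : iLowerStar.Full
  iLowerStar_faithful : iLowerStar.Faithful
  jLowerShriek_full : jLowerShriek.Full
  jLowerShriek_faithful : jLowerShriek.Faithful
  jLowerStar_full : jLowerStar.Full
  jLowerStar_faithful : jLowerStar.Faithful
  essImage_iff_isZero (b : B) : iLowerStar.essImage b ↔ IsZero (jUpperStar.obj b)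

section

variable {C : Type u} [Category.{v} C] [Abelian C]

/-- `S : K ⟶ T ⟶ M` is `Hom(P, -)`-exact: for all `W` in `P`, the sequence
`0 → Hom(W, K) → Hom(W, T) → Hom(W, M) → 0` of abelian groups is exact. -/
def IsHomFromExact (P : ObjectProperty C) (S : ShortComplex C) : Prop :=
  ∀ W : C, P W → (S.map (preadditiveCoyoneda.obj (Opposite.op W))).ShortExact

/-- `S : M ⟶ T ⟶ L` is `Hom(-, P)`-exact: for all `W` in `P`, the sequence
`0 → Hom(L, W) → Hom(T, W) → Hom(M, W) → 0` of abelian groups is exact. -/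
def IsHomToExact (P : ObjectProperty C) (S : ShortComplex C) : Prop :=
  ∀ W : C, P W → (S.op.map (preadditiveYoneda.obj W)).ShortExact

/-- The class `ξ_X` of short exact sequences that are `Hom(X, -)`-exact. -/
def xiLower (X : ObjectProperty C) : ObjectProperty (ShortComplex C) :=
  fun S ↦ S.ShortExact ∧ IsHomFromExact X S

/-- The class `ξ^Y` of short exact sequences that are `Hom(-, Y)`-exact. -/
def xiUpper (Y : ObjectProperty C) : ObjectProperty (ShortComplex C) :=
  fun S ↦ S.ShortExact ∧ IsHomToExact Y S

/-- The complex `⋯ ⟶ K₁ ⟶ K₀ ⟶ 0` is `ξ`-exact: it is spliced from sequences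
`Z (n + 1) ⟶ K n ⟶ Z n` in `ξ`. (The complex continues by `0` on the right, hence `Z 0 = 0`.) -/
def IsXiExactChain (ξ : ObjectProperty (ShortComplex C)) (K : ChainComplex C ℕ) : Prop :=
  ∃ (Z : ℕ → C) (g : ∀ n, Z (n + 1) ⟶ K.X n) (f : ∀ n, K.X n ⟶ Z n) (w : ∀ n, g n ≫ f n = 0),
    IsZero (Z 0) ∧ (∀ n, ξ (ShortComplex.mk (g n) (f n) (w n))) ∧
      ∀ n, K.d (n + 1) n = f (n + 1) ≫ g n

/-- The complex `0 ⟶ K⁰ ⟶ K¹ ⟶ ⋯` is `ξ`-exact: it is spliced from sequences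
`Z n ⟶ K n ⟶ Z (n + 1)` in `ξ`. (The complex continues by `0` on the left, hence `Z 0 = 0`.) -/
def IsXiExactCochain (ξ : ObjectProperty (ShortComplex C)) (K : CochainComplex C ℕ) : Prop :=
  ∃ (Z : ℕ → C) (g : ∀ n, Z n ⟶ K.X n) (f : ∀ n, K.X n ⟶ Z (n + 1)) (w : ∀ n, g n ≫ f n = 0),
    IsZero (Z 0) ∧ (∀ n, ξ (ShortComplex.mk (g n) (f n) (w n))) ∧
      ∀ n, K.d n (n + 1) = f n ≫ g (n + 1)

/-- Every object `M` has a short exact, `Hom(X, -)`-exact sequence `0 ⟶ K ⟶ T ⟶ M ⟶ 0` with `T`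
in `X`. -/
def StronglyContravariantlyFinite (X : ObjectProperty C) : Prop :=
  ∀ M : C, ∃ (K T : C) (k : K ⟶ T) (p : T ⟶ M) (w : k ≫ p = 0),
    X T ∧ xiLower X (ShortComplex.mk k p w)

/-- Every object `M` has a short exact, `Hom(-, Y)`-exact sequence `0 ⟶ M ⟶ T ⟶ L ⟶ 0` with `T`
in `Y`. -/
def StronglyCovariantlyFinite (Y : ObjectProperty C) : Prop :=
  ∀ M : C, ∃ (T L : C) (k : M ⟶ T) (p : T ⟶ L) (w : k ≫ p = 0),
    Y T ∧ xiUpper Y (ShortComplex.mk k p w)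

/-- `M` has an `X`-resolution `⋯ ⟶ X₁ ⟶ X₀ ⟶ M` that is `Hom(-, Y)`-exact: the terms `Xₙ` are in
`X`, and the augmented complex is spliced from sequences in `ξ_X` that are `Hom(-, Y)`-exact. -/
def HasExactResolution (X Y : ObjectProperty C) (M : C) : Prop :=
  ∃ (K : ChainComplex C ℕ) (ε : K.X 0 ⟶ M) (w : K.d 1 0 ≫ ε = 0),
    (∀ n, X (K.X n)) ∧ IsXiExactChain (xiLower X ⊓ IsHomToExact Y) (K.augment ε w)

/-- `M` has a `Y`-coresolution `M ⟶ Y⁰ ⟶ Y¹ ⟶ ⋯` that is `Hom(X, -)`-exact: the terms `Yⁿ` are in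
`Y`, and the augmented complex is spliced from sequences in `ξ^Y` that are `Hom(X, -)`-exact. -/
def HasExactCoresolution (X Y : ObjectProperty C) (M : C) : Prop :=
  ∃ (K : CochainComplex C ℕ) (η : M ⟶ K.X 0) (w : η ≫ K.d 0 1 = 0),
    (∀ n, Y (K.X n)) ∧ IsXiExactCochain (xiUpper Y ⊓ IsHomFromExact X) (K.augment η w)

/-- `P` is a full additive subcategory closed under direct summands (in particular closed under
isomorphisms; the empty product puts the zero object in `P`). -/
structure IsAdditiveSummandClosed (P : ObjectProperty C) : Prop where
  finiteProducts : P.IsClosedUnderFiniteProducts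
  retracts : P.IsStableUnderRetracts

/-- Balanced pairs `(X, Y)` of subcategories of an abelian category. -/
structure IsBalancedPair (X Y : ObjectProperty C) : Prop where
  left : IsAdditiveSummandClosed X
  right : IsAdditiveSummandClosed Y
  contravariantlyFinite : StronglyContravariantlyFinite X
  covariantlyFinite : StronglyCovariantlyFinite Y
  resolution (M : C) : HasExactResolution X Y M
  coresolution (M : C) : HasExactCoresolution X Y M

end

end GluedPairs

open GluedPairs

namespace GluedPairs

/-! ### Relative exactness and comparison in one abelian category. -/

section

variable {C : Type u} [Category.{v} C] [Abelian C]

/-! In a balanced pair, `Hom(X, -)`-exact and `Hom(-, Y)`-exact short exact sequences coincide.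
Conversely, this coincidence and (B1) give (B2) and (B3) by splicing approximations. So it suffices
to move (B1) and the coincidence to `D` along `F₁ ⊣ G₁` and `F₂ ⊣ G₂`, with `G₁`, `F₂` fully
faithful. (B1) passes through the adjunctions. If `S` is `Hom(F₁ X, -)`-exact, `G₁ S` is short exact
and `Hom(X, -)`-exact, hence `Hom(-, Y)`-exact, and full faithfulness returns this to `S`
(`IsBalancedPair.xiLower_map_le`); the other inclusion is dual. The stability hypotheses identify
`F₁ X` with the preimage of `X` under `F₂`, and `G₂ Y` with that of `Y` under `G₁`. -/

lemma isHomFromExact_iff_lift (P : ObjectProperty C) {S : ShortComplex C} (hS : S.ShortExact) :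
    IsHomFromExact P S ↔
      ∀ W, P W → ∀ f : W ⟶ S.X₃, ∃ g : W ⟶ S.X₂, g ≫ S.g = f := by
  refine ⟨fun h W hW f ↦ (h W hW).ab_surjective_g f, fun h W hW ↦ ?_⟩
  have := hS.mono_f
  refine .mk' ?_ ?_ ?_
  · rw [ShortComplex.ab_exact_iff]
    intro x hx
    exact ⟨hS.exact.lift x hx, hS.exact.lift_f x hx⟩
  · rw [AddCommGrpCat.mono_iff_injective]
    intro a b hab
    exact (cancel_mono S.f).1 hab
  · rw [AddCommGrpCat.epi_iff_surjective]
    exact h W hW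

lemma isHomToExact_iff_desc (P : ObjectProperty C) {S : ShortComplex C} (hS : S.ShortExact) :
    IsHomToExact P S ↔
      ∀ W, P W → ∀ f : S.X₁ ⟶ W, ∃ g : S.X₂ ⟶ W, S.f ≫ g = f := by
  refine ⟨fun h W hW f ↦ (h W hW).ab_surjective_g f, fun h W hW ↦ ?_⟩
  have := hS.epi_g
  refine .mk' ?_ ?_ ?_
  · rw [ShortComplex.ab_exact_iff]
    intro x hx
    exact ⟨hS.exact.desc x hx, hS.exact.g_desc x hx⟩
  · rw [AddCommGrpCat.mono_iff_injective]
    intro a b hab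
    exact (cancel_epi S.g).1 hab
  · rw [AddCommGrpCat.epi_iff_surjective]
    exact h W hW

/-- If `S₁ : Z ⟶ P ⟶ M` and `S : K ⟶ T ⟶ M` are short exact, a lift `h : P ⟶ T` over `M` exhibits
`T` as the pushout of `K` and `P` along `Z`. -/
lemma exists_desc_of_lift {S₁ S : ShortComplex C} (h₁ : S₁.ShortExact) (hS : S.ShortExact)
    (φ : S₁ ⟶ S) [IsIso φ.τ₃] {W : C} (e : S₁.X₂ ⟶ W) (f : S.X₁ ⟶ W)
    (hef : S₁.f ≫ e = φ.τ₁ ≫ f) : ∃ g : S.X₂ ⟶ W, S.f ≫ g = f := by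
  have := h₁.mono_f
  have := hS.mono_f
  have := h₁.epi_g
  have := hS.epi_g
  have : Epi (biprod.desc φ.τ₂ S.f) := by
    refine Preadditive.epi_of_cancel_zero _ fun t ht ↦ ?_
    have h2 : φ.τ₂ ≫ t = 0 := by simpa using biprod.inl ≫= ht
    have h1 : S.f ≫ t = 0 := by simpa using biprod.inr ≫= ht
    rw [← hS.exact.g_desc t h1, ← Category.assoc, φ.comm₂₃] at h2
    rw [← hS.exact.g_desc t h1]
    rw [(cancel_epi (S₁.g ≫ φ.τ₃)).1 (h2.trans comp_zero.symm), comp_zero]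
  -- The kernel of `P ⊞ K ⟶ T` consists of pairs coming from `z` in `Z` as `(z, -z)`; by `hef` the
  -- pair `(e, f)` kills them.
  have key {Q : C} (ι : Q ⟶ S₁.X₂ ⊞ S.X₁) (hι : ι ≫ biprod.desc φ.τ₂ S.f = 0) :
      ι ≫ biprod.desc e f = 0 := by
    have h0 : ι ≫ biprod.fst ≫ φ.τ₂ + ι ≫ biprod.snd ≫ S.f = 0 := by
      rw [← hι, biprod.desc_eq, Preadditive.comp_add]
    have h1 : (ι ≫ biprod.fst) ≫ S₁.g = 0 := by
      have := h0 =≫ S.g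
      simp only [Preadditive.add_comp, Category.assoc, S.zero, comp_zero, add_zero, zero_comp,
        φ.comm₂₃] at this
      rw [← cancel_mono φ.τ₃]
      simpa using this
    have h2 := h₁.exact.lift_f _ h1
    set z := h₁.exact.lift _ h1
    have h3 : ι ≫ biprod.snd = -(z ≫ φ.τ₁) := by
      rw [← cancel_mono S.f, Preadditive.neg_comp, Category.assoc, Category.assoc, φ.comm₁₂,
        reassoc_of% h2, eq_neg_iff_add_eq_zero, add_comm, h0]
    rw [biprod.desc_eq, Preadditive.comp_add, ← Category.assoc, ← h2, ← Category.assoc, h3]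
    simp [hef]
  have hd := Abelian.comp_epiDesc (biprod.desc φ.τ₂ S.f) _ (key _ (kernel.condition _))
  exact ⟨_, by rw [← biprod.inr_desc φ.τ₂ S.f, Category.assoc, hd, biprod.inr_desc]⟩

/-- If `S : K ⟶ T ⟶ L` and `S₁ : K ⟶ Q ⟶ N` are short exact, an extension `h : T ⟶ Q` under `K`
exhibits `T` as the pullback of `Q` and `L` over `N`. -/
lemma exists_lift_of_desc {S S₁ : ShortComplex C} (hS : S.ShortExact) (h₁ : S₁.ShortExact)
    (φ : S ⟶ S₁) [IsIso φ.τ₁] {W : C} (e : W ⟶ S₁.X₂) (f : W ⟶ S.X₃)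
    (hef : e ≫ S₁.g = f ≫ φ.τ₃) : ∃ g : W ⟶ S.X₂, g ≫ S.g = f := by
  have := h₁.mono_f
  have := hS.mono_f
  have := h₁.epi_g
  have := hS.epi_g
  have : Mono (biprod.lift φ.τ₂ S.g) := by
    refine Preadditive.mono_of_cancel_zero _ fun t ht ↦ ?_
    have h2 : t ≫ φ.τ₂ = 0 := by simpa using ht =≫ biprod.fst
    have h1 : t ≫ S.g = 0 := by simpa using ht =≫ biprod.snd
    rw [← hS.exact.lift_f t h1] at h2 ⊢
    rw [Category.assoc, ← φ.comm₁₂] at h2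
    rw [(cancel_mono (φ.τ₁ ≫ S₁.f)).1 (h2.trans zero_comp.symm), zero_comp]
  have key {Q : C} (π : S₁.X₂ ⊞ S.X₃ ⟶ Q) (hπ : biprod.lift φ.τ₂ S.g ≫ π = 0) :
      biprod.lift e f ≫ π = 0 := by
    have h0 : φ.τ₂ ≫ biprod.inl ≫ π + S.g ≫ biprod.inr ≫ π = 0 := by
      rw [← hπ, biprod.lift_eq, Preadditive.add_comp,
        Category.assoc, Category.assoc]
    have h1 : S₁.f ≫ (biprod.inl ≫ π) = 0 := by
      have := S.f ≫= h0
      simp only [Preadditive.comp_add, S.zero_assoc, zero_comp, add_zero, comp_zero,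
        ← φ.comm₁₂_assoc] at this
      rw [← cancel_epi φ.τ₁]
      simpa using this
    have h2 := h₁.exact.g_desc _ h1
    set z := h₁.exact.desc _ h1
    have h3 : biprod.inr ≫ π = -(φ.τ₃ ≫ z) := by
      rw [← cancel_epi S.g, Preadditive.comp_neg, ← φ.comm₂₃_assoc, h2, eq_neg_iff_add_eq_zero,
        add_comm, h0]
    rw [biprod.lift_eq, Preadditive.add_comp, Category.assoc, ← h2, Category.assoc, h3,
      reassoc_of% hef]
    simp
  have hd := Abelian.monoLift_comp (biprod.lift φ.τ₂ S.g) _ (key _ (cokernel.condition _))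
  exact ⟨_, by rw [← biprod.lift_snd φ.τ₂ S.g, ← Category.assoc, hd, biprod.lift_snd]⟩

lemma HasExactResolution.exists_shortExact {X Y : ObjectProperty C} {M : C}
    (h : HasExactResolution X Y M) :
    ∃ S₁ : ShortComplex C, S₁.ShortExact ∧ IsHomToExact Y S₁ ∧ X S₁.X₂ ∧
      Nonempty (S₁.X₃ ≅ M) := by
  obtain ⟨K, ε, w, hK, Z, g, f, w', hZ, hξ, -⟩ := h
  -- Augmentation puts `M` in degree 0; as `Z 0 = 0`, piece 0 gives `Z 1 ≅ M` and piece 1 is the one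
  -- ending at `M`.
  refine ⟨_, (hξ 1).1.1, (hξ 1).2, hK 0, ⟨?_⟩⟩
  have h0 := (hξ 0).1.1
  have := h0.isIso_f_iff.2 hZ
  exact @asIso _ _ _ _ (ShortComplex.mk (g 0) (f 0) (w' 0)).f this

lemma HasExactCoresolution.exists_shortExact {X Y : ObjectProperty C} {M : C}
    (h : HasExactCoresolution X Y M) :
    ∃ S₁ : ShortComplex C, S₁.ShortExact ∧ IsHomFromExact X S₁ ∧ Y S₁.X₂ ∧
      Nonempty (M ≅ S₁.X₁) := by
  obtain ⟨K, ε, w, hK, Z, g, f, w', hZ, hξ, -⟩ := h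
  refine ⟨_, (hξ 1).1.1, (hξ 1).2, hK 0, ⟨?_⟩⟩
  have h0 := (hξ 0).1.1
  have := h0.isIso_g_iff.2 hZ
  exact @asIso _ _ _ _ (ShortComplex.mk (g 0) (f 0) (w' 0)).g this

/-- Compare `S` with the last piece `S₁` of a resolution of `S.X₃`. Its middle term is in `X`, so it
lifts to `S.X₂`; a map `S.X₁ ⟶ W` pulled back to `S₁.X₁` extends over `S₁.X₂`, and the pushout
property glues the two maps. -/
lemma IsBalancedPair.isHomToExact {X Y : ObjectProperty C} (h : IsBalancedPair X Y)
    {S : ShortComplex C} (hS : S.ShortExact) (hX : IsHomFromExact X S) : IsHomToExact Y S := by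
  obtain ⟨S₁, h₁, hY₁, hX₁, ⟨e⟩⟩ := (h.resolution S.X₃).exists_shortExact
  rw [isHomFromExact_iff_lift X hS] at hX
  rw [isHomToExact_iff_desc Y h₁] at hY₁
  rw [isHomToExact_iff_desc Y hS]
  intro W hW f
  obtain ⟨l, hl⟩ := hX _ hX₁ (S₁.g ≫ e.hom)
  have := hS.mono_f
  have hl0 : (S₁.f ≫ l) ≫ S.g = 0 := by simp [hl]
  let φ : S₁ ⟶ S :=
    { τ₁ := hS.exact.lift _ hl0
      τ₂ := l
      τ₃ := e.hom
      comm₁₂ := hS.exact.lift_f _ hl0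
      comm₂₃ := hl }
  obtain ⟨d, hd⟩ := hY₁ W hW (φ.τ₁ ≫ f)
  exact exists_desc_of_lift h₁ hS φ d f hd

lemma IsBalancedPair.isHomFromExact {X Y : ObjectProperty C} (h : IsBalancedPair X Y)
    {S : ShortComplex C} (hS : S.ShortExact) (hY : IsHomToExact Y S) : IsHomFromExact X S := by
  obtain ⟨S₁, h₁, hX₁, hY₁, ⟨e⟩⟩ := (h.coresolution S.X₁).exists_shortExact
  rw [isHomToExact_iff_desc Y hS] at hY
  rw [isHomFromExact_iff_lift X h₁] at hX₁
  rw [isHomFromExact_iff_lift X hS]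
  intro W hW f
  obtain ⟨l, hl⟩ := hY _ hY₁ (e.hom ≫ S₁.f)
  have := hS.epi_g
  have hl0 : S.f ≫ l ≫ S₁.g = 0 := by simp [reassoc_of% hl]
  let φ : S ⟶ S₁ :=
    { τ₁ := e.hom
      τ₂ := l
      τ₃ := hS.exact.desc _ hl0
      comm₁₂ := hl.symm
      comm₂₃ := (hS.exact.g_desc _ hl0).symm }
  obtain ⟨d, hd⟩ := hX₁ W hW (f ≫ φ.τ₃)
  exact exists_lift_of_desc hS h₁ φ d f hd

/-! ### Resolutions spliced from approximations. -/

open scoped ZeroObject in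
lemma StronglyContravariantlyFinite.hasExactResolution {X Y : ObjectProperty C}
    (hX : StronglyContravariantlyFinite X) (h : xiLower X ≤ IsHomToExact Y) (M : C) :
    HasExactResolution X Y M := by
  choose K T k p w hT hξ using hX
  -- Iterated syzygies of `M`.
  let Z : ℕ → C := fun n ↦ Nat.rec M (fun _ ↦ K) n
  have hd (n : ℕ) : (p (Z (n + 1 + 1)) ≫ k (Z (n + 1))) ≫ p (Z (n + 1)) ≫ k (Z n) = 0 := by
    simp [reassoc_of% w]
  let L := ChainComplex.of (fun n ↦ T (Z n)) (fun n ↦ p (Z (n + 1)) ≫ k (Z n)) hd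
  have hL (n : ℕ) : L.d (n + 1) n = p (Z (n + 1)) ≫ k (Z n) :=
    ChainComplex.of_d (fun n ↦ T (Z n)) (fun n ↦ p (Z (n + 1)) ≫ k (Z n)) n
  have hε : L.d 1 0 ≫ p M = 0 := by
    rw [hL 0, Category.assoc]
    exact (congrArg _ (w M)).trans comp_zero
  -- The augmented complex ends in `M ⟶ 0`, so its piece 0 is `M = M ⟶ 0`, and the syzygies are
  -- shifted by one.
  have hz : (𝟙 M : M ⟶ M) ≫ (0 : M ⟶ (0 : C)) = 0 := comp_zero
  have hz' : (ShortComplex.mk (𝟙 M) (0 : M ⟶ (0 : C)) hz).ShortExact :=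
    .mk' ((ShortComplex.exact_iff_epi _ rfl).2 inferInstance) inferInstance
      ((isZero_zero C).epi _)
  have hz'' : xiLower X (ShortComplex.mk (𝟙 M) (0 : M ⟶ (0 : C)) hz) :=
    ⟨hz', (isHomFromExact_iff_lift X hz').2 fun W _ f ↦ ⟨0, (isZero_zero C).eq_of_tgt _ _⟩⟩
  refine ⟨L, p M, hε, fun n ↦ hT _, fun | 0 => 0 | n + 1 => Z n,
    fun | 0 => 𝟙 M | n + 1 => k (Z n), fun | 0 => 0 | n + 1 => p (Z n),
    fun | 0 => hz | n + 1 => w (Z n), isZero_zero C,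
    fun | 0 => ⟨hz'', h _ hz''⟩ | n + 1 => ⟨hξ _, h _ (hξ _)⟩, fun | 0 => ?_ | n + 1 => ?_⟩
  · exact (Category.comp_id _).symm
  · exact hL n

open scoped ZeroObject in
lemma StronglyCovariantlyFinite.hasExactCoresolution {X Y : ObjectProperty C}
    (hY : StronglyCovariantlyFinite Y) (h : xiUpper Y ≤ IsHomFromExact X) (M : C) :
    HasExactCoresolution X Y M := by
  choose T K k p w hT hξ using hY
  let Z : ℕ → C := fun n ↦ Nat.rec M (fun _ ↦ K) n
  have hd (n : ℕ) : (p (Z n) ≫ k (Z (n + 1))) ≫ p (Z (n + 1)) ≫ k (Z (n + 1 + 1)) = 0 := by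
    rw [Category.assoc, ← Category.assoc (k _), w, zero_comp, comp_zero]
  let L := CochainComplex.of (fun n ↦ T (Z n)) (fun n ↦ p (Z n) ≫ k (Z (n + 1))) hd
  have hL (n : ℕ) : L.d n (n + 1) = p (Z n) ≫ k (Z (n + 1)) :=
    CochainComplex.of_d (fun n ↦ T (Z n)) (fun n ↦ p (Z n) ≫ k (Z (n + 1))) n
  have hη : k M ≫ L.d 0 1 = 0 := by
    rw [hL 0, ← Category.assoc]
    exact (congrArg (· ≫ _) (w M)).trans zero_comp
  have hz : (0 : (0 : C) ⟶ M) ≫ (𝟙 M : M ⟶ M) = 0 := zero_comp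
  have hz' : (ShortComplex.mk (0 : (0 : C) ⟶ M) (𝟙 M) hz).ShortExact :=
    .mk' ((ShortComplex.exact_iff_mono _ rfl).2 inferInstance) ((isZero_zero C).mono _)
      inferInstance
  have hz'' : xiUpper Y (ShortComplex.mk (0 : (0 : C) ⟶ M) (𝟙 M) hz) :=
    ⟨hz', (isHomToExact_iff_desc Y hz').2 fun W _ f ↦ ⟨0, (isZero_zero C).eq_of_src _ _⟩⟩
  refine ⟨L, k M, hη, fun n ↦ hT _, fun | 0 => 0 | n + 1 => Z n,
    fun | 0 => 0 | n + 1 => k (Z n), fun | 0 => 𝟙 M | n + 1 => p (Z n),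
    fun | 0 => hz | n + 1 => w (Z n), isZero_zero C,
    fun | 0 => ⟨hz'', h _ hz''⟩ | n + 1 => ⟨hξ _, h _ (hξ _)⟩, fun | 0 => ?_ | n + 1 => ?_⟩
  · exact (Category.id_comp _).symm
  · exact hL n

end

/-! ### Transport along adjunctions. -/

section

variable {B : Type u₁} [Category.{v₁} B] {D : Type u₂} [Category.{v₂} D]

lemma IsAdditiveSummandClosed.inverseImage {P : ObjectProperty B} (h : IsAdditiveSummandClosed P)
    (G : D ⥤ B) [PreservesFiniteProducts G] : IsAdditiveSummandClosed (P.inverseImage G) where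
  finiteProducts :=
    ⟨fun J _ ↦ by
      have := h.finiteProducts.isClosedUnderLimitsOfShape J
      infer_instance⟩
  retracts := ⟨fun r hr ↦ h.retracts.of_retract (r.map G) hr⟩

lemma map_eq_inverseImage {P : ObjectProperty B} [P.IsClosedUnderIsomorphisms] (F : B ⥤ D)
    (G : D ⥤ B) (e : G ⋙ F ≅ 𝟭 D) (h : P.map (F ⋙ G) ≤ P) : P.map F = P.inverseImage G := by
  ext d
  rw [ObjectProperty.prop_map_iff, ObjectProperty.prop_inverseImage_iff]
  constructor
  · rintro ⟨b, hb, ⟨i⟩⟩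
    exact h _ ((ObjectProperty.prop_map_iff _ _ _).2 ⟨b, hb, ⟨G.mapIso i⟩⟩)
  · exact fun hd ↦ ⟨_, hd, ⟨e.app d⟩⟩

variable [Abelian B] [Abelian D] {F : B ⥤ D} {G : D ⥤ B}

/-- Transpose an approximation of `G.obj M`. `F` preserves epimorphisms but perhaps not kernels, so
the kernel is taken anew. -/
lemma StronglyContravariantlyFinite.map {X : ObjectProperty B}
    (hX : StronglyContravariantlyFinite X) (adj : F ⊣ G) [G.Full] [G.Faithful] :
    StronglyContravariantlyFinite (X.map F) := by
  intro M
  obtain ⟨K, T, k, p, w, hT, hS, hξ⟩ := hX (G.obj M)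
  rw [isHomFromExact_iff_lift X hS] at hξ
  have : Epi p := hS.epi_g
  have : F.IsLeftAdjoint := adj.isLeftAdjoint
  let q : F.obj T ⟶ M := F.map p ≫ adj.counit.app M
  have : Epi q := epi_comp _ _
  have hq : (ShortComplex.mk (kernel.ι q) q (kernel.condition q)).ShortExact :=
    .mk' (ShortComplex.exact_kernel q) inferInstance inferInstance
  refine ⟨_, _, kernel.ι q, q, kernel.condition q, X.prop_map_obj F hT, hq,
    (isHomFromExact_iff_lift _ hq).2 fun W hW f ↦ ?_⟩
  obtain ⟨b, hb, ⟨i⟩⟩ := (ObjectProperty.prop_map_iff _ _ _).1 hW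
  obtain ⟨g, hg⟩ := hξ b hb (adj.homEquiv _ _ (i.hom ≫ f))
  refine ⟨i.inv ≫ F.map g, ?_⟩
  dsimp [q] at hg ⊢
  rw [Category.assoc, ← F.map_comp_assoc, hg, Iso.inv_comp_eq, ← adj.homEquiv_counit,
    Equiv.symm_apply_apply]

lemma StronglyCovariantlyFinite.map {Y : ObjectProperty D}
    (hY : StronglyCovariantlyFinite Y) (adj : F ⊣ G) [F.Full] [F.Faithful] :
    StronglyCovariantlyFinite (Y.map G) := by
  intro M
  obtain ⟨T, L, k, p, w, hT, hS, hξ⟩ := hY (F.obj M)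
  rw [isHomToExact_iff_desc Y hS] at hξ
  have : Mono k := hS.mono_f
  have : G.IsRightAdjoint := adj.isRightAdjoint
  let q : M ⟶ G.obj T := adj.unit.app M ≫ G.map k
  have : Mono q := mono_comp _ _
  have hq : (ShortComplex.mk q (cokernel.π q) (cokernel.condition q)).ShortExact :=
    .mk' (ShortComplex.exact_cokernel q) inferInstance inferInstance
  refine ⟨_, _, q, cokernel.π q, cokernel.condition q, Y.prop_map_obj G hT, hq,
    (isHomToExact_iff_desc _ hq).2 fun W hW f ↦ ?_⟩
  obtain ⟨b, hb, ⟨i⟩⟩ := (ObjectProperty.prop_map_iff _ _ _).1 hW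
  obtain ⟨g, hg⟩ := hξ b hb ((adj.homEquiv _ _).symm (f ≫ i.inv))
  refine ⟨G.map g ≫ i.hom, ?_⟩
  dsimp [q] at hg ⊢
  rw [Category.assoc, ← G.map_comp_assoc, hg, ← Category.assoc, ← Iso.eq_comp_inv,
    ← adj.homEquiv_unit, Equiv.apply_symm_apply]

lemma IsBalancedPair.xiLower_map_le {X Y : ObjectProperty B} (h : IsBalancedPair X Y)
    (adj : F ⊣ G) [G.Full] [G.Faithful] [G.Additive] :
    xiLower (X.map F) ≤ IsHomToExact (Y.inverseImage G) := by
  rintro S ⟨hS, hξ⟩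
  have := hS.mono_f
  have : G.IsRightAdjoint := adj.isRightAdjoint
  rw [isHomFromExact_iff_lift _ hS] at hξ
  have lift (b : B) (hb : X b) (f : b ⟶ G.obj S.X₃) : ∃ g, g ≫ G.map S.g = f := by
    obtain ⟨g, hg⟩ := hξ _ (X.prop_map_obj F hb) ((adj.homEquiv _ _).symm f)
    exact ⟨adj.homEquiv _ _ g, by rw [← adj.homEquiv_naturality_right, hg,
      Equiv.apply_symm_apply]⟩
  -- `G` is only left exact; here an epimorphism from an object of `X` factors through `G.map S.g`.
  have : Epi (G.map S.g) := by
    obtain ⟨K, T, k, p, w, hT, hp, -⟩ := h.contravariantlyFinite (G.obj S.X₃)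
    obtain ⟨g, hg⟩ := lift T hT p
    have : Epi (g ≫ G.map S.g) := by rw [hg]; exact hp.epi_g
    exact epi_of_epi g _
  have hGS : (S.map G).ShortExact :=
    .mk' (hS.exact.map_of_mono_of_preservesKernel G hS.mono_f inferInstance)
      (inferInstanceAs (Mono (G.map S.f))) this
  have key : ∀ W, Y W → ∀ f : G.obj S.X₁ ⟶ W, ∃ g : G.obj S.X₂ ⟶ W, G.map S.f ≫ g = f :=
    (isHomToExact_iff_desc _ hGS).1
      (h.isHomToExact hGS ((isHomFromExact_iff_lift _ hGS).2 lift))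
  refine (isHomToExact_iff_desc _ hS).2 fun W hW f ↦ ?_
  obtain ⟨g, hg⟩ := key _ hW (G.map f)
  exact ⟨G.preimage g, G.map_injective (by rw [G.map_comp, G.map_preimage, hg])⟩

lemma IsBalancedPair.xiUpper_map_le {X Y : ObjectProperty D} (h : IsBalancedPair X Y)
    (adj : F ⊣ G) [F.Full] [F.Faithful] [F.Additive] :
    xiUpper (Y.map G) ≤ IsHomFromExact (X.inverseImage F) := by
  rintro S ⟨hS, hξ⟩
  have := hS.epi_g
  have : F.IsLeftAdjoint := adj.isLeftAdjoint
  rw [isHomToExact_iff_desc _ hS] at hξ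
  have desc (b : D) (hb : Y b) (f : F.obj S.X₁ ⟶ b) : ∃ g, F.map S.f ≫ g = f := by
    obtain ⟨g, hg⟩ := hξ _ (Y.prop_map_obj G hb) (adj.homEquiv _ _ f)
    exact ⟨(adj.homEquiv _ _).symm g, by rw [← adj.homEquiv_naturality_left_symm, hg,
      Equiv.symm_apply_apply]⟩
  have : Mono (F.map S.f) := by
    obtain ⟨T, L, k, p, w, hT, hp, -⟩ := h.covariantlyFinite (F.obj S.X₁)
    obtain ⟨g, hg⟩ := desc T hT k
    have : Mono (F.map S.f ≫ g) := by rw [hg]; exact hp.mono_f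
    exact mono_of_mono _ g
  have hFS : (S.map F).ShortExact :=
    .mk' (hS.exact.map_of_epi_of_preservesCokernel F hS.epi_g inferInstance)
      this (inferInstanceAs (Epi (F.map S.g)))
  have key : ∀ W, X W → ∀ f : W ⟶ F.obj S.X₃, ∃ g : W ⟶ F.obj S.X₂, g ≫ F.map S.g = f :=
    (isHomFromExact_iff_lift _ hFS).1
      (h.isHomFromExact hFS ((isHomToExact_iff_desc _ hFS).2 desc))
  refine (isHomFromExact_iff_lift _ hS).2 fun W hW f ↦ ?_
  obtain ⟨g, hg⟩ := key _ hW (F.map f)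
  exact ⟨F.preimage g, F.map_injective (by rw [F.map_comp, F.map_preimage, hg])⟩

lemma additive_of_adjunction (adj : F ⊣ G) : F.Additive ∧ G.Additive := by
  have : G.IsRightAdjoint := adj.isRightAdjoint
  have : G.Additive := Functor.additive_of_preserves_binary_products G
  exact ⟨adj.left_adjoint_additive, this⟩

/-- A balanced pair descends along a pair of (co)reflections `F₁ ⊣ G₁`, `F₂ ⊣ G₂` of `D` in `B`. -/
theorem IsBalancedPair.map_of_adjunctions {X Y : ObjectProperty B} (h : IsBalancedPair X Y)
    {F₁ G₂ : B ⥤ D} {G₁ F₂ : D ⥤ B} (adj₁ : F₁ ⊣ G₁) (adj₂ : F₂ ⊣ G₂)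
    [G₁.Full] [G₁.Faithful] [F₂.Full] [F₂.Faithful]
    (e₁ : F₂ ⋙ F₁ ≅ 𝟭 D) (e₂ : G₁ ⋙ G₂ ≅ 𝟭 D)
    (hX : X.map (F₁ ⋙ F₂) ≤ X) (hY : Y.map (G₂ ⋙ G₁) ≤ Y) :
    IsBalancedPair (X.map F₁) (Y.map G₂) := by
  obtain ⟨_, _⟩ := additive_of_adjunction adj₁
  obtain ⟨_, _⟩ := additive_of_adjunction adj₂
  have := h.left.retracts
  have := h.right.retracts
  -- Preimages inherit closure under summands, and it is for preimages that `hl` and `hu` are first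
  -- obtained.
  have hX' := map_eq_inverseImage F₁ F₂ e₁ hX
  have hY' := map_eq_inverseImage G₂ G₁ e₂ hY
  have hl := h.xiLower_map_le adj₁
  have hu := h.xiUpper_map_le adj₂
  rw [← hY'] at hl
  rw [← hX'] at hu
  have hX₁ := h.contravariantlyFinite.map adj₁
  have hY₁ := h.covariantlyFinite.map adj₂
  exact
    { left := hX' ▸ h.left.inverseImage F₂
      right := hY' ▸ h.right.inverseImage G₁
      contravariantlyFinite := hX₁
      covariantlyFinite := hY₁
      resolution := hX₁.hasExactResolution hl
      coresolution := hY₁.hasExactCoresolution hu }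

end

end GluedPairs

open GluedPairs
theorem corollary4p7
    {A : Type u₁} [Category.{v₁} A] [Abelian A]
    {B : Type u₂} [Category.{v₂} B] [Abelian B]
    {C : Type u₃} [Category.{v₃} C] [Abelian C]
    (R : Recollement A B C) (X Y : ObjectProperty B) (hXY : IsBalancedPair X Y)
    (hjX : X.map (R.jUpperStar ⋙ R.jLowerShriek) ≤ X)
    (hjY : Y.map (R.jUpperStar ⋙ R.jLowerStar) ≤ Y)
    (hiX : X.map (R.iUpperStar ⋙ R.iLowerStar) ≤ X)
    (hiY : Y.map (R.iUpperShriek ⋙ R.iLowerStar) ≤ Y) :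
    IsBalancedPair (X.map R.jUpperStar) (Y.map R.jUpperStar) ∧
      IsBalancedPair (X.map R.iUpperStar) (Y.map R.iUpperShriek) := by
  have := R.iLowerStar_full
  have := R.iLowerStar_faithful
  have := R.jLowerShriek_full
  have := R.jLowerShriek_faithful
  have := R.jLowerStar_full
  have := R.jLowerStar_faithful
  -- For `C`, `j^*` serves as both `F₁` and `G₂`; for `A`, `i_*` serves as both `G₁` and `F₂`.
  exact ⟨hXY.map_of_adjunctions R.jAdj' R.jAdj (asIso R.jAdj.unit).symm (asIso R.jAdj'.counit)
      hjX hjY,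
    hXY.map_of_adjunctions R.iAdj R.iAdj' (asIso R.iAdj.counit) (asIso R.iAdj'.unit).symm
      hiX hiY⟩
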